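/- Let $K$ be a field, $n\ge 1$, $S=K[x_1,\ldots,x_n]$, $\mathfrak m=(x_1,\ldots,x_n)$, and $\mathbf e=(1,\ldots,1)\in\mathbb Z^n$. For a monomial $u=x_1^{a_1}\cdots x_n^{a_n}$ put $\mathrm{Deg}(u)=(a_1,\ldots,a_n)$, and for $\mathbf c\in\mathbb Z^n$ call $u$ $\mathbf c$-bounded if $\mathrm{Deg}(u)\le\mathbf c$ componentwise. For a monomial ideal $I\subset S$ let $G(I)$ be its minimal set of monomial generators; $I$ is called $\mathbf c$-bounded strongly stable if every $u\in G(I)$ is $\mathbf c$-bounded and, for all $u\in G(I)$ and all $i<j$ such that $x_j\mid u$ and $x_iu/x_j$ is $\mathbf c$-bounded, one has $x_iu/x_j\in I$. The ideal $I$ is generated in degree $e$ if all elements of $G(I)$ have degree $e$ (the zero ideal is generated in every degree, including negative ones). Let $J_0(I)=I$, and for $\ell\ge1$ let $J_\ell(I)$ be the ideal generated by the monomials in $(I:\mathfrak m^\ell)\setminus(I:\mathfrak m^{\ell-1})$, that is, by the monomials whose residue classes form the unique monomial $K$-basis of $(I:\mathfrak m^\ell)/(I:\mathfrak m^{\ell-1})$.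 Let $\mathrm{sat}(I)=\min\{k\ge 0 : I:\mathfrak m^k=I:\mathfrak m^{k+1}\}$. **Theorem.** Let $\mathbf c\in\mathbb Z^n$, $d\ge 0$, and let $I\subset S$ be a $\mathbf c$-bounded strongly stable ideal generated in degree $d$. (a) For all $\ell\ge1$, $J_\ell(I)$ is a $(\mathbf c-\ell\mathbf e)$-bounded strongly stable ideal generated in degree $d-\ell$, and if $J_{\ell-1}(I)\neq0$, then $$J_\ell(I)=\bigl(u/x_n^\ell : u\in G(I),\ x_n^\ell\mid u,\ \mathrm{Deg}(u/x_n^\ell)\le\mathbf c-\ell\mathbf e\bigr).$$ (b) If $I\ne0$, then $\mathrm{sat}(I)$ is the largest integer $\ell\ge0$ for which there exists $u\in G(I)$ with $x_n^\ell\mid u$ and $\mathrm{Deg}(u/x_n^\ell)\le\mathbf c-\ell\mathbf e$. -/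

import Mathlib

open MvPolynomial

noncomputable section

namespace SatMonomial

variable {n : ℕ} {K : Type*} [Field K]

/-- A monomial `x^a` of `K[x_1, …, x_n]` is represented by its multidegree `a`;
`mon K a` is the monomial itself. -/
def mon (K : Type*) [Field K] (a : Fin n →₀ ℕ) : MvPolynomial (Fin n) K := monomial a 1

/-- An ideal that is generated by monomials. -/
def IsMonomialIdeal (I : Ideal (MvPolynomial (Fin n) K)) : Prop :=
  ∃ A : Set (Fin n →₀ ℕ), I = Ideal.span (mon K '' A)

/-- The minimal set `G(I)` of monomial generators of a monomial ideal (as a set of multidegrees):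
the monomials in `I` that are minimal with respect to divisibility. -/
def minGens (I : Ideal (MvPolynomial (Fin n) K)) : Set (Fin n →₀ ℕ) :=
  {a | Minimal (fun b => mon K b ∈ I) a}

/-- A monomial ideal is generated in degree `e` if all elements of `G(I)` have degree `e`. The
degree is an integer; for `e < 0` only the zero ideal qualifies. -/
def GeneratedInDegree (e : ℤ) (I : Ideal (MvPolynomial (Fin n) K)) : Prop :=
  ∀ a ∈ minGens I, (a.degree : ℤ) = e

/-- `x^a` is `c`-bounded, that is, `a ≤ c` componentwise. -/
def IsBounded (c : Fin n → ℤ) (a : Fin n →₀ ℕ) : Prop := ∀ i, (a i : ℤ) ≤ c i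

/-- `c`-bounded strongly stable monomial ideals. -/
structure IsBoundedStronglyStable (c : Fin n → ℤ) (I : Ideal (MvPolynomial (Fin n) K)) :
    Prop where
  isMonomial : IsMonomialIdeal I
  bounded : ∀ a ∈ minGens I, IsBounded c a
  exchange : ∀ a ∈ minGens I, ∀ i j : Fin n, i < j → 0 < a j →
    IsBounded c (a - Finsupp.single j 1 + Finsupp.single i 1) →
    mon K (a - Finsupp.single j 1 + Finsupp.single i 1) ∈ I

/-- `I : 𝔪 ^ ℓ`, where `𝔪 = (x_1, …, x_n)`. -/
def colonPow (I : Ideal (MvPolynomial (Fin n) K)) (ℓ : ℕ) : Ideal (MvPolynomial (Fin n) K) :=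
  I.colon ((idealOfVars (Fin n) K ^ ℓ : Ideal (MvPolynomial (Fin n) K)) :
    Set (MvPolynomial (Fin n) K))

theorem colonPow_mono (I : Ideal (MvPolynomial (Fin n) K)) : Monotone (colonPow I) :=
  fun _ _ h => Submodule.colon_mono le_rfl (Ideal.pow_le_pow_right h)

theorem exists_colonPow_eq (I : Ideal (MvPolynomial (Fin n) K)) :
    ∃ k, colonPow I k = colonPow I (k + 1) := by
  obtain ⟨k, hk⟩ := monotone_stabilizes_iff_noetherian.mpr
    (inferInstance : IsNoetherian (MvPolynomial (Fin n) K) (MvPolynomial (Fin n) K))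
    ⟨colonPow I, colonPow_mono I⟩
  exact ⟨k, hk (k + 1) (Nat.le_succ k)⟩

open Classical in
/-- The saturation number: the least `k` with `I : 𝔪 ^ k = I : 𝔪 ^ (k + 1)`. -/
def sat (I : Ideal (MvPolynomial (Fin n) K)) : ℕ := Nat.find (exists_colonPow_eq I)

/-- `J_0(I) = I`; for `ℓ ≥ 1`, `J_ℓ(I)` is generated by the monomials whose residue classes form
the monomial `K`-basis of `(I : 𝔪 ^ ℓ) / (I : 𝔪 ^ (ℓ - 1))` (for `I` monomial), that is, by the
monomials in `I : 𝔪 ^ ℓ` that are not in `I : 𝔪 ^ (ℓ - 1)`. -/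
def J (I : Ideal (MvPolynomial (Fin n) K)) : ℕ → Ideal (MvPolynomial (Fin n) K)
  | 0 => I
  | ℓ + 1 => Ideal.span (mon K '' {a | mon K a ∈ colonPow I (ℓ + 1) ∧ mon K a ∉ colonPow I ℓ})

/-- The vector `c - ℓ e`, where `e = (1, …, 1)`. -/
def shift (c : Fin n → ℤ) (ℓ : ℕ) : Fin n → ℤ := fun i => c i - ℓ

/-- The multidegrees `a` of the `u = x^a ∈ G(I)` such that `x_n ^ ℓ` divides `u` and
`Deg (u / x_n ^ ℓ) ≤ c - ℓ e`. Here the number of variables is `m + 1` and `x_n` is the last one. -/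
def admissible {m : ℕ} (c : Fin (m + 1) → ℤ) (I : Ideal (MvPolynomial (Fin (m + 1)) K)) (ℓ : ℕ) :
    Set (Fin (m + 1) →₀ ℕ) :=
  {a | a ∈ minGens I ∧ ℓ ≤ a (Fin.last m) ∧
    IsBounded (shift c ℓ) (a - Finsupp.single (Fin.last m) ℓ)}

end SatMonomial

end

/-!
The theorem rests on one description of the monomials generating `J_ℓ(I)`: for `ℓ ≥ 1`, a monomial
`v` lies in `(I : 𝔪 ^ ℓ) \ (I : 𝔪 ^ (ℓ - 1))` if and only if `v` has degree `d - ℓ`, is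
`(c - ℓ e)`-bounded, and `v x_n ^ ℓ ∈ I` (`mon_mem_colonPow_diff_iff`).

The case `ℓ = 1` gives the degree. If `v ∉ I` while `v x_i ∈ I` for all `i`, then `v x_n` is
divisible by some `u ∈ G(I)` whose `x_n`-exponent is one more than that of `v`. Were `u` a proper
divisor of `v x_n`, it would have a smaller exponent than `v` at some `i < n`; but `v x_i ∈ I` forces
`v_i + 1 ≤ c_i`, so `x_i u / x_n` would be a bounded exchange of `u` dividing `v`, contradicting
`v ∉ I`. Hence `v` has degree `d - 1` (`degree_add_one_of_socle`). For general `ℓ` there is `w` of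
degree `ℓ - 1` with `v w ∉ I`, and `v w` is of the kind just considered, so `v` has degree `d - ℓ`.
Then the `v x_i ^ ℓ` have degree `d`, so they are minimal generators, whence the bound. Conversely,
any `v w` with `w` of degree `ℓ` is reached from `v x_n ^ ℓ` by successive exchanges which, all being
of the form `v w'`, stay bounded (`mon_add_mem_of_add_last_mem`); and `v x_n ^ (ℓ - 1) ∉ I` for
degree reasons.

The monomials so described have the same degree, so they are exactly the minimal generators of
`J_ℓ(I)`, and they inherit the exchange property from `I`. Multiplication by `x_n ^ ℓ` puts them in
bijection with the admissible generators of `I`. This gives (a). As the ideals `I : 𝔪 ^ ℓ` are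
monomial, two consecutive ones differ exactly if there is an admissible generator of the
corresponding level; admissibility at a level implies admissibility at all lower levels, which
gives (b).
-/

namespace SatMonomial

open Finsupp

/-! ### Monomial ideals and their colon ideals -/

section Monomial

variable {n : ℕ} {K : Type*} [Field K] {I : Ideal (MvPolynomial (Fin n) K)}

theorem mon_add (a b : Fin n →₀ ℕ) : mon K (a + b) = mon K a * mon K b := by
  simp [mon]

theorem mon_mem_of_le {a b : Fin n →₀ ℕ} (h : a ≤ b) (ha : mon K a ∈ I) : mon K b ∈ I := by
  rw [← add_tsub_cancel_of_le h, mon_add]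
  exact I.mul_mem_right _ ha

theorem mem_span_mon {A : Set (Fin n →₀ ℕ)} {f : MvPolynomial (Fin n) K} :
    f ∈ Ideal.span (mon K '' A) ↔ ∀ b ∈ f.support, ∃ a ∈ A, a ≤ b :=
  mem_ideal_span_monomial_image

theorem mon_mem_span_mon {A : Set (Fin n →₀ ℕ)} {b : Fin n →₀ ℕ} :
    mon K b ∈ Ideal.span (mon K '' A) ↔ ∃ a ∈ A, a ≤ b := by
  classical
  rw [mem_span_mon, mon, support_monomial, if_neg one_ne_zero]
  simp

theorem IsMonomialIdeal.mem_iff (hI : IsMonomialIdeal I) {f : MvPolynomial (Fin n) K} :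
    f ∈ I ↔ ∀ a ∈ f.support, mon K a ∈ I := by
  obtain ⟨A, rfl⟩ := hI
  simp_rw [mem_span_mon (f := f), mon_mem_span_mon]

theorem mem_colonPow {f : MvPolynomial (Fin n) K} {ℓ : ℕ} :
    f ∈ colonPow I ℓ ↔ ∀ w : Fin n →₀ ℕ, w.degree = ℓ → f * mon K w ∈ I := by
  rw [colonPow, pow_idealOfVars_eq_span]
  unfold Ideal.span
  rw [Submodule.colon_span]
  simp [Submodule.mem_colon, mon]

theorem mon_mem_colonPow {a : Fin n →₀ ℕ} {ℓ : ℕ} :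
    mon K a ∈ colonPow I ℓ ↔ ∀ w : Fin n →₀ ℕ, w.degree = ℓ → mon K (a + w) ∈ I := by
  simp_rw [mem_colonPow, mon_add]

/-- The colon ideals of a monomial ideal are again determined by their monomials. -/
theorem IsMonomialIdeal.mem_colonPow_iff (hI : IsMonomialIdeal I) {f : MvPolynomial (Fin n) K}
    {ℓ : ℕ} : f ∈ colonPow I ℓ ↔ ∀ a ∈ f.support, mon K a ∈ colonPow I ℓ := by
  classical
  simp_rw [mon_mem_colonPow, mem_colonPow, hI.mem_iff (f := _ * _)]
  constructor
  · intro h a ha w hw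
    refine h w hw _ ?_
    rw [MvPolynomial.mem_support_iff, mon, coeff_mul_monomial, mul_one]
    exact MvPolynomial.mem_support_iff.1 ha
  · intro h w hw b hb
    rw [MvPolynomial.mem_support_iff, mon, coeff_mul_monomial', mul_one] at hb
    by_cases hle : w ≤ b
    · rw [if_pos hle] at hb
      simpa [tsub_add_cancel_of_le hle] using h (b - w) (MvPolynomial.mem_support_iff.2 hb) w hw
    · simp [hle] at hb

theorem mon_mem_of_mem_minGens {a : Fin n →₀ ℕ} (ha : a ∈ minGens I) : mon K a ∈ I :=
  Minimal.prop (P := fun b => mon K b ∈ I) ha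

theorem exists_minGens_le {a : Fin n →₀ ℕ} (ha : mon K a ∈ I) : ∃ b ∈ minGens I, b ≤ a := by
  obtain ⟨b, hb, h⟩ := exists_minimal_le_of_wellFoundedLT (fun b => mon K b ∈ I) a ha
  exact ⟨b, h, hb⟩

theorem eq_of_le_of_degree_le {a b : Fin n →₀ ℕ} (h : a ≤ b) (hdeg : b.degree ≤ a.degree) :
    a = b := by
  obtain ⟨e, rfl⟩ := le_iff_exists_add.1 h
  have : e = 0 := (degree_eq_zero_iff e).1 (by rw [map_add] at hdeg; omega)
  simp [this]

theorem minGens_span_mon {A : Set (Fin n →₀ ℕ)} {e : ℕ} (hA : ∀ a ∈ A, a.degree = e) :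
    minGens (Ideal.span (mon K '' A)) = A := by
  ext a
  simp only [minGens, mon_mem_span_mon, Set.mem_ofPred_eq]
  constructor
  · rintro ⟨⟨b, hb, hba⟩, hmin⟩
    rwa [le_antisymm (hmin ⟨b, hb, le_rfl⟩ hba) hba]
  · intro ha
    refine ⟨⟨a, ha, le_rfl⟩, ?_⟩
    rintro b ⟨a', ha', h⟩ hba
    rwa [← eq_of_le_of_degree_le (h.trans hba) (by rw [hA a ha, hA a' ha'])]

theorem GeneratedInDegree.le_degree {d : ℕ} (hd : GeneratedInDegree (d : ℤ) I)
    {a : Fin n →₀ ℕ} (ha : mon K a ∈ I) : d ≤ a.degree := by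
  obtain ⟨b, hb, hba⟩ := exists_minGens_le ha
  have h1 := hd b hb
  have h2 : b.degree ≤ a.degree := degree_mono hba
  omega

theorem GeneratedInDegree.mem_minGens {d : ℕ} (hd : GeneratedInDegree (d : ℤ) I)
    {a : Fin n →₀ ℕ} (ha : mon K a ∈ I) (hdeg : a.degree = d) : a ∈ minGens I :=
  ⟨ha, fun _ hb hba =>
    (eq_of_le_of_degree_le hba (hdeg.trans_le (hd.le_degree hb))).ge⟩

/-- The exchange property in subtraction-free form: `x_j` is replaced by `x_i` in `x^b x_j`. -/
theorem IsBoundedStronglyStable.exchange_add {c : Fin n → ℤ} {d : ℕ}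
    (hI : IsBoundedStronglyStable c I) (hd : GeneratedInDegree (d : ℤ) I) {b : Fin n →₀ ℕ}
    {i j : Fin n} (hij : i < j) (hdeg : b.degree + 1 = d) (hmem : mon K (b + single j 1) ∈ I)
    (hbd : IsBounded c (b + single i 1)) : mon K (b + single i 1) ∈ I := by
  have h := hI.exchange _ (hd.mem_minGens hmem (by simp [hdeg])) i j hij (by simp)
  rw [add_tsub_cancel_right] at h
  exact h hbd

end Monomial

/-! ### The monomials generating `J_ℓ(I)` -/

section Layer

variable {m : ℕ} {K : Type*} [Field K] {I : Ideal (MvPolynomial (Fin (m + 1)) K)}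
  {c : Fin (m + 1) → ℤ} {d : ℕ}

/-- The socle monomials of `S / I` have degree `d - 1`. -/
theorem degree_add_one_of_socle (hI : IsBoundedStronglyStable c I)
    (hd : GeneratedInDegree (d : ℤ) I) {v : Fin (m + 1) →₀ ℕ} (hv : mon K v ∉ I)
    (hsoc : ∀ i, mon K (v + single i 1) ∈ I) : v.degree + 1 = d := by
  classical
  -- A generator dividing `x^v x_i` does not divide `x^v`, so its exponent at `i` is `v i + 1`.
  have key : ∀ i, ∃ u ∈ minGens I, u ≤ v + single i 1 ∧ u i = v i + 1 := by
    intro i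
    obtain ⟨u, hu, hle⟩ := exists_minGens_le (hsoc i)
    refine ⟨u, hu, hle, ?_⟩
    by_contra hne
    refine hv (mon_mem_of_le (fun k => ?_) (mon_mem_of_mem_minGens hu))
    have hk := hle k
    rw [Finsupp.add_apply, single_apply] at hk
    split_ifs at hk with hik
    · subst hik; omega
    · simpa using hk
  obtain ⟨u, hu, hle, hlast⟩ := key (Fin.last m)
  have hdu : u.degree = d := by exact_mod_cast hd u hu
  by_cases heq : u = v + single (Fin.last m) 1
  · rw [← hdu, heq]; simp
  obtain ⟨i, hi⟩ : ∃ i, u i < (v + single (Fin.last m) 1 : Fin (m + 1) →₀ ℕ) i := by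
    by_contra! h
    exact heq (le_antisymm hle h)
  have hin : i ≠ Fin.last m := by
    rintro rfl
    simp [hlast] at hi
  have hiv : u i < v i := by simpa [single_apply, hin.symm] using hi
  obtain ⟨u', hu', -, hi'⟩ := key i
  have hci := hI.bounded u' hu' i
  -- `b` is `u / x_n`; then `x^b x_i` divides `x^v`.
  obtain ⟨b, rfl⟩ : ∃ b, u = b + single (Fin.last m) 1 :=
    ⟨u - single (Fin.last m) 1, (tsub_add_cancel_of_le (by simp [hlast])).symm⟩
  have hcu := hI.bounded _ hu
  have hbi : b i < v i := by simpa [single_apply, hin.symm] using hiv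
  refine absurd (mon_mem_of_le ?_ (hI.exchange_add hd (Fin.lt_last_iff_ne_last.2 hin)
    (by simpa using hdu) (mon_mem_of_mem_minGens hu) ?_)) hv
  · intro k
    have hk : b k ≤ v k := by simpa using hle k
    rw [Finsupp.add_apply, single_apply]
    split_ifs with hik
    · subst hik; omega
    · simpa using hk
  · intro k
    have hk := hcu k
    rw [Finsupp.add_apply] at hk ⊢
    by_cases hik : i = k
    · subst hik; simp; omega
    · rw [single_eq_of_ne (Ne.symm hik)]; push_cast at hk ⊢; omega

/-- By successive exchanges, every `x^v x^w` with `w` of degree `ℓ` is reached from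
`x^v x_n ^ ℓ`. -/
theorem mon_add_mem_of_add_last_mem (hI : IsBoundedStronglyStable c I)
    (hd : GeneratedInDegree (d : ℤ) I) {v : Fin (m + 1) →₀ ℕ} {ℓ : ℕ} (hdeg : v.degree + ℓ = d)
    (hbd : IsBounded (shift c ℓ) v) (hmem : mon K (v + single (Fin.last m) ℓ) ∈ I)
    {w : Fin (m + 1) →₀ ℕ} (hw : w.degree = ℓ) : mon K (v + w) ∈ I := by
  classical
  induction hk : ℓ - w (Fin.last m) generalizing w with
  | zero =>
    have hle : single (Fin.last m) ℓ ≤ w := by simp; omega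
    rwa [← eq_of_le_of_degree_le hle (by simp [hw])]
  | succ k ih =>
    obtain ⟨i, hin, hi⟩ : ∃ i, i ≠ Fin.last m ∧ w i ≠ 0 := by
      by_contra! h
      have : w = single (Fin.last m) (w (Fin.last m)) := by
        ext i
        by_cases hi : i = Fin.last m
        · simp [hi]
        · rw [h i hi, single_eq_of_ne hi]
      have := congrArg degree this
      rw [degree_single] at this
      omega
    obtain ⟨w, rfl⟩ : ∃ b, w = b + single i 1 :=
      ⟨w - single i 1, (tsub_add_cancel_of_le (by simp; omega)).symm⟩
    have hwn : (w + single i 1 : Fin (m + 1) →₀ ℕ) (Fin.last m) = w (Fin.last m) := by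
      simp [hin]
    have hwd : w.degree + 1 = ℓ := by simpa using hw
    rw [← add_assoc]
    refine hI.exchange_add hd (Fin.lt_last_iff_ne_last.2 hin) (by rw [map_add]; omega) ?_ ?_
    · rw [add_assoc]
      refine ih (by simpa using hwd) ?_
      simp
      omega
    · intro k
      have h1 := Finsupp.le_degree k (w + single i 1)
      have h2 := hbd k
      rw [add_assoc, Finsupp.add_apply]
      simp only [shift] at h2
      omega

/-- The multidegrees of degree `d - ℓ`, bounded by `c - ℓ e`, whose product with `x_n ^ ℓ` lies
in `I`. The degree condition is written additively, so the set is empty for `ℓ > d`. -/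
def layer (c : Fin (m + 1) → ℤ) (d : ℕ) (I : Ideal (MvPolynomial (Fin (m + 1)) K)) (ℓ : ℕ) :
    Set (Fin (m + 1) →₀ ℕ) :=
  {v | v.degree + ℓ = d ∧ IsBounded (shift c ℓ) v ∧ mon K (v + single (Fin.last m) ℓ) ∈ I}

theorem mon_mem_colonPow_diff_iff (hI : IsBoundedStronglyStable c I)
    (hd : GeneratedInDegree (d : ℤ) I) {v : Fin (m + 1) →₀ ℕ} {ℓ : ℕ} :
    mon K v ∈ colonPow I (ℓ + 1) ∧ mon K v ∉ colonPow I ℓ ↔ v ∈ layer c d I (ℓ + 1) := by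
  constructor
  · rintro ⟨h1, h2⟩
    rw [mon_mem_colonPow] at h1 h2
    push Not at h2
    obtain ⟨w, hw, hvw⟩ := h2
    have hdeg : v.degree + (ℓ + 1) = d := by
      rw [← degree_add_one_of_socle hI hd hvw fun i => by
        rw [add_assoc]; exact h1 _ (by simp [hw]), map_add, hw, add_assoc]
    refine ⟨hdeg, fun i => ?_, h1 _ (by simp)⟩
    have := hI.bounded _ (hd.mem_minGens (h1 (single i (ℓ + 1)) (by simp)) (by simpa)) i
    simp only [Finsupp.add_apply, single_eq_same] at this
    simp only [shift]
    push_cast at this ⊢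
    omega
  · rintro ⟨hdeg, hbd, hmem⟩
    refine ⟨mon_mem_colonPow.2 fun w hw => mon_add_mem_of_add_last_mem hI hd hdeg hbd hmem hw,
      fun h => ?_⟩
    have := hd.le_degree (mon_mem_colonPow.1 h (single (Fin.last m) ℓ) (by simp))
    rw [map_add, degree_single] at this
    omega

theorem J_succ_eq (hI : IsBoundedStronglyStable c I) (hd : GeneratedInDegree (d : ℤ) I) (ℓ : ℕ) :
    J I (ℓ + 1) = Ideal.span (mon K '' layer c d I (ℓ + 1)) := by
  simp only [J, mon_mem_colonPow_diff_iff hI hd, Set.ofPred_mem_eq]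

theorem minGens_J_succ (hI : IsBoundedStronglyStable c I) (hd : GeneratedInDegree (d : ℤ) I)
    (ℓ : ℕ) : minGens (J I (ℓ + 1)) = layer c d I (ℓ + 1) := by
  rw [J_succ_eq hI hd]
  exact minGens_span_mon (e := d - (ℓ + 1)) fun a ha => by have := ha.1; omega

theorem isBoundedStronglyStable_J_succ (hI : IsBoundedStronglyStable c I)
    (hd : GeneratedInDegree (d : ℤ) I) (ℓ : ℕ) :
    IsBoundedStronglyStable (shift c (ℓ + 1)) (J I (ℓ + 1)) where
  isMonomial := ⟨_, J_succ_eq hI hd ℓ⟩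
  bounded a ha := by
    rw [minGens_J_succ hI hd] at ha
    exact ha.2.1
  exchange a ha i j hij haj hbd := by
    rw [minGens_J_succ hI hd] at ha
    obtain ⟨b, rfl⟩ : ∃ b, a = b + single j 1 :=
      ⟨a - single j 1, (tsub_add_cancel_of_le (by simp; omega)).symm⟩
    rw [add_tsub_cancel_right] at hbd ⊢
    obtain ⟨hdeg, -, hmem⟩ := ha
    rw [map_add, degree_single] at hdeg
    rw [J_succ_eq hI hd]
    refine Ideal.subset_span ⟨_, ⟨by simpa using hdeg, hbd, ?_⟩, rfl⟩
    rw [add_right_comm] at hmem ⊢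
    refine hI.exchange_add hd hij (by rw [map_add, degree_single]; omega) hmem fun k => ?_
    have h1 := hbd k
    have h2 := Finsupp.le_degree k (single (Fin.last m) (ℓ + 1))
    rw [degree_single] at h2
    rw [add_right_comm, Finsupp.add_apply]
    simp only [shift] at h1
    omega

/-! ### Admissible generators and the saturation number -/

theorem image_admissible (hd : GeneratedInDegree (d : ℤ) I) (ℓ : ℕ) :
    (fun a => a - single (Fin.last m) ℓ) '' admissible c I ℓ = layer c d I ℓ := by
  ext v
  constructor
  · rintro ⟨a, ⟨ha, hℓ, hbd⟩, rfl⟩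
    have hle : single (Fin.last m) ℓ ≤ a := by simpa using hℓ
    have hda := hd a ha
    refine ⟨?_, hbd, ?_⟩
    · have := congrArg degree (tsub_add_cancel_of_le hle)
      rw [map_add, degree_single] at this
      dsimp only
      omega
    · simpa only [tsub_add_cancel_of_le hle] using mon_mem_of_mem_minGens ha
  · rintro ⟨hdeg, hbd, hmem⟩
    exact ⟨v + single (Fin.last m) ℓ, ⟨hd.mem_minGens hmem (by simpa using hdeg), by simp,
      by simpa using hbd⟩, by simp⟩

/-- Passing from `u / x_n ^ ℓ` to `u / x_n ^ ℓ'` with `ℓ' ≤ ℓ` raises only the last exponent, and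
by no more than the bound grows. -/
theorem admissible_antitone : Antitone (admissible c I) := by
  rintro ℓ' ℓ h a ⟨ha, hℓ, hbd⟩
  refine ⟨ha, h.trans hℓ, fun i => ?_⟩
  have := hbd i
  simp only [shift, Finsupp.tsub_apply] at this ⊢
  by_cases hi : i = Fin.last m
  · subst hi
    simp only [single_eq_same] at this ⊢
    omega
  · rw [single_eq_of_ne hi] at this ⊢
    omega

theorem admissible_succ_nonempty_iff (hI : IsBoundedStronglyStable c I)
    (hd : GeneratedInDegree (d : ℤ) I) (ℓ : ℕ) :
    (admissible c I (ℓ + 1)).Nonempty ↔ colonPow I ℓ ≠ colonPow I (ℓ + 1) := by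
  rw [← Set.image_nonempty (f := fun a => a - single (Fin.last m) (ℓ + 1)), image_admissible hd]
  constructor
  · rintro ⟨v, hv⟩ heq
    rw [← mon_mem_colonPow_diff_iff hI hd, heq] at hv
    exact hv.2 hv.1
  · intro hne
    by_contra hempty
    refine hne (le_antisymm (colonPow_mono I ℓ.le_succ) fun f hf => ?_)
    rw [hI.isMonomial.mem_colonPow_iff] at hf ⊢
    intro a ha
    by_contra hna
    exact hempty ⟨a, (mon_mem_colonPow_diff_iff hI hd).1 ⟨hf a ha, hna⟩⟩

theorem admissible_zero_nonempty (hI : IsBoundedStronglyStable c I) (hne : I ≠ ⊥) :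
    (admissible c I 0).Nonempty := by
  obtain ⟨f, hf, hf0⟩ := Submodule.exists_mem_ne_zero_of_ne_bot hne
  obtain ⟨a, ha⟩ := support_nonempty.2 hf0
  obtain ⟨b, hb, -⟩ := exists_minGens_le (hI.isMonomial.mem_iff.1 hf a ha)
  exact ⟨b, hb, Nat.zero_le _, fun i => by simpa [shift] using hI.bounded b hb i⟩

theorem isGreatest_sat (hI : IsBoundedStronglyStable c I) (hd : GeneratedInDegree (d : ℤ) I)
    (hne : I ≠ ⊥) : IsGreatest {ℓ : ℕ | (admissible c I ℓ).Nonempty} (sat I) := by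
  classical
  constructor
  · cases hs : sat I with
    | zero => exact admissible_zero_nonempty hI hne
    | succ k =>
      refine (admissible_succ_nonempty_iff hI hd k).2
        (Nat.find_min (exists_colonPow_eq I) (m := k) ?_)
      have : k < sat I := by omega
      simpa only [sat] using! this
  · intro ℓ hℓ
    by_contra! hlt
    exact (admissible_succ_nonempty_iff hI hd (sat I)).1
      (hℓ.mono (admissible_antitone hlt)) (Nat.find_spec (exists_colonPow_eq I))

end Layer

end SatMonomial

theorem mainTheorem4 {K : Type*} [Field K] {m : ℕ} (c : Fin (m + 1) → ℤ) (d : ℕ)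
    (I : Ideal (MvPolynomial (Fin (m + 1)) K))
    (hI : SatMonomial.IsBoundedStronglyStable c I)
    (hd : SatMonomial.GeneratedInDegree (d : ℤ) I) :
    (∀ ℓ : ℕ, 1 ≤ ℓ →
      SatMonomial.IsBoundedStronglyStable (SatMonomial.shift c ℓ) (SatMonomial.J I ℓ) ∧
      SatMonomial.GeneratedInDegree ((d : ℤ) - ℓ) (SatMonomial.J I ℓ) ∧
      (SatMonomial.J I (ℓ - 1) ≠ ⊥ →
        SatMonomial.J I ℓ = Ideal.span
          ((fun a => SatMonomial.mon K (a - Finsupp.single (Fin.last m) ℓ)) ''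
            SatMonomial.admissible c I ℓ))) ∧
    (I ≠ ⊥ →
      IsGreatest {ℓ : ℕ | (SatMonomial.admissible c I ℓ).Nonempty} (SatMonomial.sat I)) := by
  refine ⟨fun ℓ hℓ => ?_, SatMonomial.isGreatest_sat hI hd⟩
  obtain ⟨ℓ, rfl⟩ := Nat.exists_eq_add_of_le' hℓ
  refine ⟨SatMonomial.isBoundedStronglyStable_J_succ hI hd ℓ, fun a ha => ?_, fun _ => ?_⟩
  · rw [SatMonomial.minGens_J_succ hI hd] at ha
    have := ha.1
    omega
  · rw [SatMonomial.J_succ_eq hI hd, ← SatMonomial.image_admissible hd, Set.image_image]
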